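/- **Lemma** ($L_{1,1,0}(n,1)=1$). Consider circuits, i.e. finite strings of gates read left to right, over the gates $\mathrm{NOT}(a): a\mapsto a\oplus 1$, $\mathrm{CNOT}(a;b): (a,b)\mapsto(a,b\oplus a)$ and $\mathrm{TOF}(a,b;c): (a,b,c)\mapsto(a,b,c\oplus ab)$, where the wires of each gate are pairwise distinct. Besides the variable inputs, a circuit may have ancillae, i.e. input wires that are initialised to constants $0$ or $1$ (which may be chosen depending on the function to be implemented). A reversible function of $n$ variables is a bijection $f:\{0,1\}^n\to\{0,1\}^n$. A circuit implements $f$ * *strongly*, if it maps $x\mapsto f(x)$ (on the $n$ wires of $x$) and returns the ancillae to their initial values; * *intermediately*, if it maps $(x,y)\mapsto(x,y\oplus f(x))$ for all $x,y\in\{0,1\}^n$ (on $2n$ variable wires) and returns the ancillae to their initial values; * *weakly*, if, on variable inputs $x$, each of the $n$ components of $f(x)$ is carried by some wire at the end of the circuit. For any one of these three notions, and $a,b,c\in\{0,1\}$, let the cost of a circuit be the sum of the weights of its gates, where NOT, CNOT and Toffoli gates have weights $a$, $b$ and $c$, and let $$L_{a,b,c}(n,g)=\max_f\ \min_C\ \mathrm{cost}(C),$$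 where $f$ ranges over all reversible functions of $n$ variables, and $C$ over all circuits that implement $f$ and use at most $g$ ancillae. Then, for each of the three notions of implementation and every $n\ge 1$, $$L_{1,1,0}(n,1)=1.$$ That is, with at most one ancilla every reversible $n$-bit function is implemented by a circuit that contains at most one gate which is a NOT or a CNOT (and any number of Toffoli gates), and some reversible $n$-bit function cannot be implemented by Toffoli gates alone. Moreover, for every $n\ge 2$, the function $(x_1,\dots,x_n)\mapsto(x_1\oplus1,x_2\oplus1,x_3,\dots,x_n)$ is such a function: the minimal number of NOT and CNOT gates in a circuit that implements it with at most one ancilla is exactly $1$. -/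

import Mathlib

/-! ## NOT / CNOT / Toffoli circuits -/

/-- A NOT, CNOT or Toffoli gate acting on wires from `W`. The last wire listed is the target,
the wires before it are the controls; the wires of one gate are pairwise distinct. -/
inductive NCTGate (W : Type) : Type
  | not (a : W) : NCTGate W
  | cnot (a b : W) (hab : a ≠ b) : NCTGate W
  | tof (a b c : W) (hab : a ≠ b) (hac : a ≠ c) (hbc : b ≠ c) : NCTGate W

namespace NCTGate

/-- The transformation of the Boolean values on the wires performed by a gate. -/
def apply {W : Type} [DecidableEq W] : NCTGate W → (W → Bool) → (W → Bool)
  | not a, s => Function.update s a (xor (s a) true)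
  | cnot a b _, s => Function.update s b (xor (s b) (s a))
  | tof a b c _ _ _, s => Function.update s c (xor (s c) (s a && s b))

/-- The cost of a gate when NOT, CNOT, Toffoli gates have weights `a`, `b`, `c`. -/
def weight {W : Type} (a b c : ℕ) : NCTGate W → ℕ
  | not _ => a
  | cnot _ _ _ => b
  | tof _ _ _ _ _ _ => c

end NCTGate

/-- A reversible NCT circuit on the wires `W`: a string of gates, read left to right. -/
abbrev NCTCircuit (W : Type) : Type := List (NCTGate W)

namespace NCTCircuit

/-- The values carried by the wires after all gates of the circuit have been applied. -/
def run {W : Type} [DecidableEq W] (C : NCTCircuit W) (s : W → Bool) : W → Bool :=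
  C.foldl (fun t G => G.apply t) s

/-- The sum of the weights of all gates of the circuit. -/
def cost {W : Type} (a b c : ℕ) (C : NCTCircuit W) : ℕ :=
  (C.map (NCTGate.weight a b c)).sum

end NCTCircuit

/-- A reversible function of `n` Boolean variables: a bijection of the Boolean cube. -/
abbrev ReversibleFunction (n : ℕ) : Type := Equiv.Perm (Fin n → Bool)

/-- The three notions of what it means to implement a reversible function by a circuit. -/
inductive Implementation : Type
  | weak
  | intermediate
  | strong

/-- Weak implementation with ancillae initialised to `v`: each output of `f` is carried
by some wire at the end of the circuit. -/
def WeaklyImplements {n m : ℕ} (C : NCTCircuit (Fin n ⊕ Fin m)) (v : Fin m → Bool)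
    (f : ReversibleFunction n) : Prop :=
  ∀ i : Fin n, ∃ w : Fin n ⊕ Fin m, ∀ x : Fin n → Bool, C.run (Sum.elim x v) w = f x i

/-- Intermediate implementation with ancillae initialised to `v`: the circuit maps `(x, y)` to
`(x, y ⊕ f x)` and returns the ancillae to their original values. -/
def IntermediatelyImplements {n m : ℕ} (C : NCTCircuit (Fin n ⊕ (Fin n ⊕ Fin m)))
    (v : Fin m → Bool) (f : ReversibleFunction n) : Prop :=
  ∀ x y : Fin n → Bool,
    C.run (Sum.elim x (Sum.elim y v)) = Sum.elim x (Sum.elim (fun i => xor (y i) (f x i)) v)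

/-- Strong implementation with ancillae initialised to `v`: the circuit maps `x` to `f x` and
returns the ancillae to their original values. -/
def StronglyImplements {n m : ℕ} (C : NCTCircuit (Fin n ⊕ Fin m)) (v : Fin m → Bool)
    (f : ReversibleFunction n) : Prop :=
  ∀ x : Fin n → Bool, C.run (Sum.elim x v) = Sum.elim (f x) v

/-- `f` has an implementation of the given kind with cost exactly `k` that uses at most `g`
input constants, each of value 0 or 1. -/
def IsImplementationCost (a b c g : ℕ) {n : ℕ} (f : ReversibleFunction n) (k : ℕ) :
    Implementation → Prop
  | .weak => ∃ m ≤ g, ∃ (v : Fin m → Bool) (C : NCTCircuit (Fin n ⊕ Fin m)),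
      WeaklyImplements C v f ∧ C.cost a b c = k
  | .intermediate => ∃ m ≤ g, ∃ (v : Fin m → Bool) (C : NCTCircuit (Fin n ⊕ (Fin n ⊕ Fin m))),
      IntermediatelyImplements C v f ∧ C.cost a b c = k
  | .strong => ∃ m ≤ g, ∃ (v : Fin m → Bool) (C : NCTCircuit (Fin n ⊕ Fin m)),
      StronglyImplements C v f ∧ C.cost a b c = k

/-- The smallest cost of an implementation of `f` with at most `g` input constants
(`⊤` if there is none). -/
noncomputable def minCost (κ : Implementation) (a b c g : ℕ) {n : ℕ}
    (f : ReversibleFunction n) : ℕ∞ :=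
  ⨅ (k : ℕ) (_ : IsImplementationCost a b c g f k κ), (k : ℕ∞)

/-- `L_{a,b,c}(n,g)`: the smallest cost of an implementation of the most expensive reversible
function of `n` variables, with at most `g` input constants. -/
noncomputable def complexityL (κ : Implementation) (a b c n g : ℕ) : ℕ∞ :=
  ⨆ f : ReversibleFunction n, minCost κ a b c g f

/-- The reversible function `(x₁ ⊕ 1, x₂ ⊕ 1, x₃, …, xₙ)`. -/
def negateFirstTwo (n : ℕ) : ReversibleFunction n :=
  Function.Involutive.toPerm
    (fun (x : Fin n → Bool) (i : Fin n) => if (i : ℕ) < 2 then xor (x i) true else x i)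
    (by intro x; funext i; by_cases h : (i : ℕ) < 2 <;> simp [h])

/-! Cost 0 means Toffoli gates only, and a Toffoli gate fixes every state with at most one wire
`true`. This gives the lower bound: on input zero, a single ancilla leaves at most one wire `true`,
so nothing changes, although `negateFirstTwo` must produce ones. For the upper bound, an ancilla
kept at `true` turns Toffoli gates into CNOTs. They then realise exactly the permutations fixing
zero: `swap_true_mem_toffoliPerms` swaps any nonzero state with the all-ones state, and such
transpositions generate the rest (`mem_toffoliPerms_of_fixes_zero`). A general `f` needs just one
NOT, to move zero. -/

namespace NCTGate

/-- Relabel the wires of a gate. -/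
def relabel {W W' : Type} (e : W ≃ W') : NCTGate W → NCTGate W'
  | not a => not (e a)
  | cnot a b h => cnot (e a) (e b) (e.injective.ne h)
  | tof a b c h₁ h₂ h₃ =>
    tof (e a) (e b) (e c) (e.injective.ne h₁) (e.injective.ne h₂) (e.injective.ne h₃)

theorem apply_relabel {W W' : Type} [DecidableEq W] [DecidableEq W'] (e : W ≃ W')
    (G : NCTGate W) (s : W' → Bool) : (G.relabel e).apply s = G.apply (s ∘ e) ∘ e.symm := by
  cases G <;> simp [relabel, apply, Function.update_comp_equiv, Function.comp_assoc]

theorem weight_relabel {W W' : Type} (e : W ≃ W') (a b c : ℕ) (G : NCTGate W) :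
    (G.relabel e).weight a b c = G.weight a b c := by
  cases G <;> rfl

/-- A Toffoli gate fixes every state in which at most one wire carries `true`. -/
theorem apply_eq_self_of_weight_eq_zero {W : Type} [DecidableEq W] {G : NCTGate W}
    (hG : G.weight 1 1 0 = 0) {s : W → Bool}
    (hs : ∀ i j, s i = true → s j = true → i = j) : G.apply s = s := by
  cases G with
  | not a => simp [weight] at hG
  | cnot a b h => simp [weight] at hG
  | tof a b c hab hac hbc =>
    have : (s a && s b) = false := by
      by_contra h
      simp only [Bool.not_eq_false, Bool.and_eq_true] at h
      exact hab (hs a b h.1 h.2)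
    simp [apply, this]

end NCTGate

/-! ### Circuits of Toffoli gates -/

namespace NCTCircuit

variable {W : Type}

theorem run_append [DecidableEq W] (C D : NCTCircuit W) (s : W → Bool) :
    run (C ++ D) s = D.run (C.run s) := by
  simp [run]

theorem cost_append (a b c : ℕ) (C D : NCTCircuit W) :
    cost a b c (C ++ D) = C.cost a b c + D.cost a b c := by
  simp [cost]

/-- Relabel the wires of a circuit. -/
def relabel {W' : Type} (e : W ≃ W') (C : NCTCircuit W) : NCTCircuit W' :=
  C.map (NCTGate.relabel e)

theorem run_relabel {W' : Type} [DecidableEq W] [DecidableEq W'] (e : W ≃ W')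
    (C : NCTCircuit W) (s : W' → Bool) : (C.relabel e).run s = C.run (s ∘ e) ∘ e.symm := by
  induction C generalizing s with
  | nil => simp [relabel, run, Function.comp_assoc]
  | cons G C ih =>
    have := ih ((G.relabel e).apply s)
    simp only [relabel, run, List.map_cons, List.foldl_cons] at this ⊢
    rw [this, NCTGate.apply_relabel]
    simp [Function.comp_assoc]

theorem cost_relabel {W' : Type} (e : W ≃ W') (a b c : ℕ) (C : NCTCircuit W) :
    (C.relabel e).cost a b c = C.cost a b c := by
  simp [relabel, cost, Function.comp_def, NCTGate.weight_relabel]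

theorem run_eq_self_of_cost_eq_zero [DecidableEq W] {C : NCTCircuit W}
    (hC : C.cost 1 1 0 = 0) {s : W → Bool}
    (hs : ∀ i j, s i = true → s j = true → i = j) : C.run s = s := by
  induction C with
  | nil => rfl
  | cons G C ih =>
    simp only [cost, List.map_cons, List.sum_cons, Nat.add_eq_zero_iff] at hC
    simp only [run, List.foldl_cons, NCTGate.apply_eq_self_of_weight_eq_zero hC.1 hs]
    exact ih hC.2

theorem run_eq_self_of_card_le_two [Fintype W] [DecidableEq W] (hW : Fintype.card W ≤ 2)
    {C : NCTCircuit W} (hC : C.cost 1 1 0 = 0) (s : W → Bool) : C.run s = s := by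
  cases C with
  | nil => rfl
  | cons G C =>
    simp only [cost, List.map_cons, List.sum_cons, Nat.add_eq_zero_iff] at hC
    cases G with
    | not a => simp [NCTGate.weight] at hC
    | cnot a b h => simp [NCTGate.weight] at hC
    | tof a b c hab hac hbc =>
      have := Fintype.two_lt_card_iff.2 ⟨a, b, c, hab, hac, hbc⟩
      omega

/-- Toffoli gates implement the NOT gate on `t` controlled by two or more wires `A`, provided
that, for three or more controls, there is a further wire (whose value is arbitrary). -/
theorem exists_run_eq_controlledNot [DecidableEq W] (A : Finset W) (hA : 2 ≤ A.card) (t : W)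
    (ht : t ∉ A) (hd : A.card = 2 ∨ ∃ d, d ≠ t ∧ d ∉ A) :
    ∃ C : NCTCircuit W, C.cost 1 1 0 = 0 ∧
      ∀ s, C.run s = Function.update s t (xor (s t) (decide (∀ i ∈ A, s i = true))) := by
  induction A using Finset.induction_on generalizing t with
  | empty => simp at hA
  | insert b A hb ih =>
    rw [Finset.card_insert_of_notMem hb] at hA hd
    simp only [Finset.mem_insert, not_or] at ht hd
    by_cases h1 : A.card = 1
    · obtain ⟨a, rfl⟩ := Finset.card_eq_one.1 h1
      simp only [Finset.mem_singleton] at hb ht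
      refine ⟨[.tof b a t hb (Ne.symm ht.1) (Ne.symm ht.2)], rfl, fun s => ?_⟩
      simp [run, NCTGate.apply, Bool.decide_and]
    · obtain ⟨d, hdt, hdb, hdA⟩ := hd.resolve_left (by omega)
      -- With the target moved to `d`, the wire `b` becomes the spare one.
      obtain ⟨C, hC, hCr⟩ := ih (by omega) d hdA (.inr ⟨b, Ne.symm hdb, hb⟩)
      let T : NCTCircuit W := [.tof b d t (Ne.symm hdb) (Ne.symm ht.1) hdt]
      -- Write `q` for the conjunction over `A`. The target gains `b(d ⊕ q) ⊕ bd = bq`, so the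
      -- unknown value of `d` cancels; the second `C` restores `d`.
      refine ⟨C ++ (T ++ (C ++ T)), ?_, fun s => ?_⟩
      · simp only [cost_append, hC]; rfl
      · have hTr : ∀ s, T.run s = Function.update s t (xor (s t) (s b && s d)) := fun _ => rfl
        have key : ∀ (s : W → Bool) (j : W) (v : Bool), j ∉ A →
            decide (∀ i ∈ A, Function.update s j v i = true) =
              decide (∀ i ∈ A, s i = true) := by
          intro s j v hj
          refine decide_eq_decide.2 (forall₂_congr fun i hi => ?_)
          rw [Function.update_of_ne (ne_of_mem_of_not_mem hi hj)]
        simp only [run_append, hCr, hTr, key _ d _ hdA, key _ t _ ht.2]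
        have e : decide (∀ i ∈ insert b A, s i = true) =
            (s b && decide (∀ i ∈ A, s i = true)) := by
          simp [Bool.decide_and]
        rw [e]
        generalize decide (∀ i ∈ A, s i = true) = q
        have hbt : b ≠ t := Ne.symm ht.1
        have hbd : b ≠ d := Ne.symm hdb
        funext w
        by_cases hwt : w = t
        · subst hwt
          simp only [Function.update_self, Function.update_of_ne hdt, Function.update_of_ne hbt,
            Function.update_of_ne hbd, Function.update_of_ne hdt.symm]
          cases s w <;> cases s b <;> cases s d <;> cases q <;> rfl
        · by_cases hwd : w = d
          · subst hwd
            simp only [Function.update_self, Function.update_of_ne hwt]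
            cases s w <;> cases q <;> rfl
          · simp [Function.update_of_ne hwt, Function.update_of_ne hwd]

end NCTCircuit

/-! ### Permutations realised with an ancilla of value `true` -/

section UnitAncilla

variable {V : Type} [DecidableEq V]

/-- The permutations of the states of the wires `V` that Toffoli gates implement with one
ancilla, which is initialised to `true` and returned to this value. -/
def toffoliPerms (V : Type) [DecidableEq V] : Submonoid (Equiv.Perm (V → Bool)) where
  carrier := {f | ∃ C : NCTCircuit (V ⊕ Fin 1), C.cost 1 1 0 = 0 ∧
    ∀ x, C.run (Sum.elim x fun _ => true) = Sum.elim (f x) fun _ => true}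
  one_mem' := ⟨[], rfl, fun _ => rfl⟩
  mul_mem' := by
    rintro f g ⟨C, hC, hCr⟩ ⟨D, hD, hDr⟩
    refine ⟨D ++ C, by rw [NCTCircuit.cost_append, hC, hD], fun x => ?_⟩
    rw [NCTCircuit.run_append, hDr, hCr, Equiv.Perm.mul_apply]

/-- The permutation of states performed by a CNOT gate. -/
def cnotPerm (a b : V) (hab : a ≠ b) : Equiv.Perm (V → Bool) :=
  Function.Involutive.toPerm (fun x => Function.update x b (xor (x b) (x a))) fun x => by
    simp [Function.update_of_ne hab]

/-- The permutation of states performed by a NOT gate. -/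
def notPerm (a : V) : Equiv.Perm (V → Bool) :=
  Function.Involutive.toPerm (fun x => Function.update x a (xor (x a) true)) fun x => by simp

theorem cnotPerm_apply (a b : V) (hab : a ≠ b) (x : V → Bool) :
    cnotPerm a b hab x = Function.update x b (xor (x b) (x a)) := rfl

theorem notPerm_apply (a : V) (x : V → Bool) :
    notPerm a x = Function.update x a (xor (x a) true) := rfl

theorem cnotPerm_mem_toffoliPerms (a b : V) (hab : a ≠ b) :
    cnotPerm a b hab ∈ toffoliPerms V := by
  refine ⟨[.tof (.inl a) (.inr 0) (.inl b) (by simp) (by simpa using hab) (by simp)], rfl,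
    fun x => ?_⟩
  simp only [NCTCircuit.run, NCTGate.apply, cnotPerm_apply, List.foldl_cons, List.foldl_nil,
    Sum.update_elim_inl, Sum.elim_inl, Sum.elim_inr, Bool.and_true]

variable [Fintype V]

/-- This transposition is the NOT on `t` controlled by all other wires of `V`; the ancilla is the
spare wire. -/
theorem swap_update_true_mem_toffoliPerms {s t : V} (hst : s ≠ t) :
    Equiv.swap (Function.update (fun _ => true) t false) (fun _ => true) ∈ toffoliPerms V := by
  have hswap : ∀ x : V → Bool,
      Equiv.swap (Function.update (fun _ => true) t false) (fun _ => true) x =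
        Function.update x t (xor (x t) (decide (∀ i, i ≠ t → x i = true))) := by
    intro x
    by_cases h : ∀ i, i ≠ t → x i = true
    · have hx : x = Function.update (fun _ => true) t (x t) := by
        funext i
        by_cases hi : i = t
        · subst hi; simp
        · simp [hi, h i hi]
      rw [decide_eq_true h]
      generalize x t = b at hx
      subst hx
      cases b <;> simp
    · rw [decide_eq_false h, Equiv.swap_apply_of_ne_of_ne]
      · simp
      · rintro rfl
        exact h fun i hi => by simp [hi]
      · rintro rfl
        exact h fun i hi => rfl
  -- With only one control the gate is a CNOT, outside the scope of the controlled-NOT lemma.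
  by_cases h2 : Finset.univ.erase t = {s}
  · have : Equiv.swap (Function.update (fun _ => true) t false) (fun _ => true) =
        cnotPerm s t hst := by
      ext1 x
      rw [hswap, cnotPerm_apply]
      have : (∀ i, i ≠ t → x i = true) ↔ x s = true := by
        have : ∀ i, i ≠ t ↔ i = s := fun i => by simpa using Finset.ext_iff.1 h2 i
        simp [this]
      simp [this]
    rw [this]
    exact cnotPerm_mem_toffoliPerms s t hst
  · have hcard : 2 ≤ (Finset.univ.erase t).card := by
      by_contra hlt
      refine h2 (Finset.eq_singleton_iff_unique_mem.2 ⟨by simp [hst], fun i hi => ?_⟩)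
      exact Finset.card_le_one.1 (by omega) i hi s (by simp [hst])
    obtain ⟨C, hC, hCr⟩ := NCTCircuit.exists_run_eq_controlledNot
      ((Finset.univ.erase t).map (Function.Embedding.inl (β := Fin 1)))
      (by rwa [Finset.card_map]) (.inl t) (by simp) (.inr ⟨.inr 0, by simp, by simp⟩)
    refine ⟨C, hC, fun x => ?_⟩
    rw [hCr, hswap, Sum.update_elim_inl]
    simp only [Finset.forall_mem_map, Finset.mem_erase, Finset.mem_univ, and_true,
      Function.Embedding.inl_apply, Sum.elim_inl]

/-- Any state other than the zero state may be swapped with the all-ones state. -/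
theorem swap_true_mem_toffoliPerms (u : V → Bool) (hu : u ≠ fun _ => false) :
    Equiv.swap u (fun _ => true) ∈ toffoliPerms V := by
  induction hk : (Finset.univ.filter fun i => u i = false).card generalizing u with
  | zero =>
    have : u = fun _ => true := by
      funext i
      simpa using (Finset.filter_eq_empty_iff.1 (Finset.card_eq_zero.1 hk)) (Finset.mem_univ i)
    rw [this, Equiv.swap_self]
    exact one_mem _
  | succ k ih =>
    obtain ⟨t, ht⟩ := Finset.card_pos.1 (by omega :
      0 < (Finset.univ.filter fun i => u i = false).card)
    have htf : u t = false := by simpa using ht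
    -- A wire `s` carrying `true` is the control that lets a CNOT flip `t`.
    obtain ⟨s, hs⟩ := Function.ne_iff.1 hu
    have hs : u s = true := by simpa using hs
    have hst : s ≠ t := by rintro rfl; simp [hs] at htf
    have hu' : Function.update u t true ≠ fun _ => false := by
      intro h
      simpa using congrFun h t
    have hfilter : (Finset.univ.filter fun i => Function.update u t true i = false) =
        (Finset.univ.filter fun i => u i = false).erase t := by
      ext i
      by_cases hi : i = t
      · subst hi; simp
      · simp [hi]
    have h := ih _ hu' (by rw [hfilter, Finset.card_erase_of_mem ht, hk]; rfl)
    have hg := cnotPerm_mem_toffoliPerms s t hst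
    have hinv : (cnotPerm s t hst)⁻¹ = cnotPerm s t hst := rfl
    -- Conjugation by the self-inverse CNOT turns the swap of `Function.update u t true` with
    -- all-ones into the swap of `u` with the state that is `false` only at `t`.
    have hconj := mul_mem (mul_mem hg h) hg
    nth_rewrite 2 [← hinv] at hconj
    rw [← Equiv.swap_apply_apply] at hconj
    have e₁ : cnotPerm s t hst (Function.update u t true) = u := by
      simp [cnotPerm_apply, hst, hs, ← htf]
    have e₂ : cnotPerm s t hst (fun _ => true) = Function.update (fun _ => true) t false := by
      simp [cnotPerm_apply]
    rw [e₁, e₂] at hconj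
    exact SubmonoidClass.swap_mem_trans _ hconj (swap_update_true_mem_toffoliPerms hst)

/-- With an ancilla of value `true`, Toffoli gates implement every permutation of states that
fixes the zero state. -/
theorem mem_toffoliPerms_of_fixes_zero (f : Equiv.Perm (V → Bool))
    (hf : f (fun _ => false) = fun _ => false) : f ∈ toffoliPerms V := by
  induction hk : f.support.card using Nat.strong_induction_on generalizing f with
  | _ k ih =>
  by_cases h1 : f = 1
  · rw [h1]; exact one_mem _
  obtain ⟨x, hx⟩ : ∃ x, f x ≠ x := by
    by_contra! h
    exact h1 (Equiv.ext h)
  have hx0 : x ≠ fun _ => false := by rintro rfl; exact hx hf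
  have hfx0 : f x ≠ fun _ => false := fun h => hx0 (f.injective (h.trans hf.symm))
  -- Splitting off this transposition shrinks the support; neither `x` nor `f x` is zero, so it
  -- factors through all-ones.
  have hg := ih _ (hk ▸ Equiv.Perm.card_support_swap_mul hx) (Equiv.swap x (f x) * f)
    (by rw [Equiv.Perm.mul_apply, hf, Equiv.swap_apply_of_ne_of_ne hx0.symm hfx0.symm]) rfl
  have hswap : Equiv.swap x (f x) ∈ toffoliPerms V :=
    SubmonoidClass.swap_mem_trans _ (swap_true_mem_toffoliPerms x hx0)
      (Equiv.swap_comm (f x) _ ▸ swap_true_mem_toffoliPerms (f x) hfx0)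
  simpa using mul_mem hswap hg

/-- With an ancilla of value `true`, every permutation of states is implemented by Toffoli gates
and at most one NOT gate. -/
theorem exists_circuit_cost_le_one [Nonempty V] (f : Equiv.Perm (V → Bool)) :
    ∃ C : NCTCircuit (V ⊕ Fin 1), C.cost 1 1 0 ≤ 1 ∧
      ∀ x, C.run (Sum.elim x fun _ => true) = Sum.elim (f x) fun _ => true := by
  by_cases hf : f (fun _ => false) = fun _ => false
  · obtain ⟨C, hC, hCr⟩ := mem_toffoliPerms_of_fixes_zero f hf
    exact ⟨C, hC.le.trans zero_le_one, hCr⟩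
  obtain ⟨i⟩ := ‹Nonempty V›
  set p := f.symm fun _ => false with hp
  have hp0 : p ≠ fun _ => false := by
    intro h
    rw [← h, hp, Equiv.apply_symm_apply] at hf
    exact hf (hp.symm.trans h).symm
  set e : V → Bool := Function.update (fun _ => false) i true with he
  have he0 : e ≠ fun _ => false := by
    intro h
    simpa [he] using congrFun h i
  obtain ⟨B, hB, hBr⟩ := mem_toffoliPerms_of_fixes_zero (Equiv.swap p e)
    (Equiv.swap_apply_of_ne_of_ne hp0.symm he0.symm)
  -- Zero travels to `e`, then to `p`, then back to zero, so this product needs no NOT.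
  obtain ⟨A, hA, hAr⟩ := mem_toffoliPerms_of_fixes_zero (f * Equiv.swap p e * notPerm i) (by
    have : notPerm i (fun _ => false) = e := by simp [notPerm_apply, he]
    rw [Equiv.Perm.mul_apply, Equiv.Perm.mul_apply, this, Equiv.swap_apply_right, hp,
      Equiv.apply_symm_apply])
  have hNr : ∀ x : V → Bool, NCTCircuit.run [.not (.inl i)] (Sum.elim x fun _ : Fin 1 => true) =
      Sum.elim (notPerm i x) fun _ => true := by
    intro x
    simp only [NCTCircuit.run, NCTGate.apply, notPerm_apply, List.foldl_cons, List.foldl_nil,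
      Sum.update_elim_inl, Sum.elim_inl]
  refine ⟨B ++ ([.not (.inl i)] ++ A), ?_, fun x => ?_⟩
  · rw [NCTCircuit.cost_append, NCTCircuit.cost_append, hA, hB]
    exact le_rfl
  · rw [NCTCircuit.run_append, NCTCircuit.run_append, hBr, hNr, hAr]
    have : notPerm i (notPerm i (Equiv.swap p e x)) = Equiv.swap p e x := by
      simp [notPerm_apply]
    simp [this]

end UnitAncilla

/-! ### The three notions of implementation -/

theorem StronglyImplements.weaklyImplements {n m : ℕ} {C : NCTCircuit (Fin n ⊕ Fin m)}
    {v : Fin m → Bool} {f : ReversibleFunction n} (h : StronglyImplements C v f) :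
    WeaklyImplements C v f :=
  fun i => ⟨.inl i, fun x => by rw [h x]; rfl⟩

/-- The permutation `(x, y) ↦ (x, y ⊕ f x)`. -/
def xorPerm {n : ℕ} (f : ReversibleFunction n) : Equiv.Perm (Fin n ⊕ Fin n → Bool) :=
  Function.Involutive.toPerm
    (fun s => Sum.elim (s ∘ .inl) fun i => xor (s (.inr i)) (f (s ∘ .inl) i)) fun s => by
    funext w
    cases w <;> simp

theorem xorPerm_elim {n : ℕ} (f : ReversibleFunction n) (x y : Fin n → Bool) :
    xorPerm f (Sum.elim x y) = Sum.elim x fun i => xor (y i) (f x i) := rfl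

theorem exists_isImplementationCost_le_one (κ : Implementation) {n : ℕ} (hn : 1 ≤ n)
    (f : ReversibleFunction n) : ∃ k ≤ 1, IsImplementationCost 1 1 0 1 f k κ := by
  have : Nonempty (Fin n) := ⟨⟨0, hn⟩⟩
  cases κ with
  | weak =>
    obtain ⟨C, hC, hCr⟩ := exists_circuit_cost_le_one f
    exact ⟨_, hC, 1, le_rfl, fun _ => true, C,
      StronglyImplements.weaklyImplements hCr, rfl⟩
  | strong =>
    obtain ⟨C, hC, hCr⟩ := exists_circuit_cost_le_one f
    exact ⟨_, hC, 1, le_rfl, fun _ => true, C, hCr, rfl⟩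
  | intermediate =>
    obtain ⟨C, hC, hCr⟩ := exists_circuit_cost_le_one (xorPerm f)
    refine ⟨_, hC, 1, le_rfl, fun _ => true, C.relabel (Equiv.sumAssoc _ _ _), fun x y => ?_,
      NCTCircuit.cost_relabel _ _ _ _ C⟩
    have e : (Sum.elim x (Sum.elim y fun _ : Fin 1 => true)) ∘ Equiv.sumAssoc _ _ _ =
        Sum.elim (Sum.elim x y) fun _ => true := by
      funext w
      rcases w with (w | w) | w <;> rfl
    rw [NCTCircuit.run_relabel, e, hCr, xorPerm_elim]
    funext w
    rcases w with w | w | w <;> rfl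

theorem negateFirstTwo_apply {n : ℕ} (x : Fin n → Bool) (i : Fin n) :
    negateFirstTwo n x i = if (i : ℕ) < 2 then xor (x i) true else x i := rfl

/-- On input zero the variable wires stay `false`, so each negated output must sit on the ancilla.
For `n ≥ 2` one ancilla cannot carry two different outputs; for `n = 1` there are too few wires for
any Toffoli gate. -/
theorem not_weaklyImplements_negateFirstTwo {n m : ℕ} (hn : 1 ≤ n) (hm : m ≤ 1)
    (v : Fin m → Bool) {C : NCTCircuit (Fin n ⊕ Fin m)} (hC : C.cost 1 1 0 = 0) :
    ¬ WeaklyImplements C v (negateFirstTwo n) := by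
  intro h
  have hsub : Subsingleton (Fin m) := Fin.subsingleton_iff_le_one.2 hm
  have hfix : C.run (Sum.elim (fun _ => false) v) = Sum.elim (fun _ => false) v := by
    refine NCTCircuit.run_eq_self_of_cost_eq_zero hC fun i j hi hj => ?_
    rcases i with i | i <;> rcases j with j | j <;> simp at hi hj
    rw [Subsingleton.elim i j]
  have hanc : ∀ i : Fin n, (i : ℕ) < 2 →
      ∃ w : Fin m, ∀ x, C.run (Sum.elim x v) (.inr w) = negateFirstTwo n x i := by
    intro i hi
    obtain ⟨w | w, hw⟩ := h i
    · have := hw fun _ => false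
      simp [hfix, negateFirstTwo_apply, hi] at this
    · exact ⟨w, hw⟩
  obtain ⟨w, hw⟩ := hanc ⟨0, hn⟩ (by simp)
  by_cases h2 : 2 ≤ n
  · obtain ⟨w', hw'⟩ := hanc ⟨1, h2⟩ (by simp)
    obtain rfl := Subsingleton.elim w w'
    -- An input on which the first two outputs differ.
    have := (hw fun i => decide ((i : ℕ) = 0)).symm.trans (hw' _)
    simp [negateFirstTwo_apply] at this
  · have hrun := NCTCircuit.run_eq_self_of_card_le_two (C := C) (by simp; omega) hC
    have h₀ := hw fun _ => false
    have h₁ := hw fun _ => true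
    rw [hrun] at h₀ h₁
    have := h₀.symm.trans h₁
    simp [negateFirstTwo_apply] at this

theorem not_intermediatelyImplements_negateFirstTwo {n m : ℕ} (hn : 1 ≤ n) (hm : m ≤ 1)
    (v : Fin m → Bool) {C : NCTCircuit (Fin n ⊕ (Fin n ⊕ Fin m))} (hC : C.cost 1 1 0 = 0) :
    ¬ IntermediatelyImplements C v (negateFirstTwo n) := by
  intro h
  have hsub : Subsingleton (Fin m) := Fin.subsingleton_iff_le_one.2 hm
  -- Only the ancilla can be `true` here, so the state is fixed, yet the first target wire should
  -- become `true`.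
  have hxy := h (fun _ => false) fun _ => false
  rw [NCTCircuit.run_eq_self_of_cost_eq_zero hC] at hxy
  · have := congrFun hxy (.inr (.inl ⟨0, hn⟩))
    simp [negateFirstTwo_apply] at this
  · intro i j hi hj
    rcases i with i | i | i <;> rcases j with j | j | j <;> simp at hi hj
    rw [Subsingleton.elim i j]

theorem not_isImplementationCost_zero_negateFirstTwo (κ : Implementation) {n : ℕ} (hn : 1 ≤ n) :
    ¬ IsImplementationCost 1 1 0 1 (negateFirstTwo n) 0 κ := by
  cases κ with
  | weak =>
    rintro ⟨m, hm, v, C, h, hC⟩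
    exact not_weaklyImplements_negateFirstTwo hn hm v hC h
  | intermediate =>
    rintro ⟨m, hm, v, C, h, hC⟩
    exact not_intermediatelyImplements_negateFirstTwo hn hm v hC h
  | strong =>
    rintro ⟨m, hm, v, C, h, hC⟩
    exact not_weaklyImplements_negateFirstTwo hn hm v hC h.weaklyImplements

theorem minCost_le_one (κ : Implementation) {n : ℕ} (hn : 1 ≤ n) (f : ReversibleFunction n) :
    minCost κ 1 1 0 1 f ≤ 1 := by
  obtain ⟨k, hk, h⟩ := exists_isImplementationCost_le_one κ hn f
  exact (iInf₂_le k h).trans (by exact_mod_cast hk)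

theorem minCost_negateFirstTwo (κ : Implementation) {n : ℕ} (hn : 1 ≤ n) :
    minCost κ 1 1 0 1 (negateFirstTwo n) = 1 := by
  refine le_antisymm (minCost_le_one κ hn _) (le_iInf₂ fun k hk => ?_)
  have : k ≠ 0 := by
    rintro rfl
    exact not_isImplementationCost_zero_negateFirstTwo κ hn hk
  exact_mod_cast Nat.one_le_iff_ne_zero.2 this

theorem mainTheorem4 (κ : Implementation) (n : ℕ) (hn : 1 ≤ n) :
    complexityL κ 1 1 0 n 1 = 1 ∧
      (2 ≤ n → minCost κ 1 1 0 1 (negateFirstTwo n) = 1) := by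
  refine ⟨le_antisymm (iSup_le fun f => minCost_le_one κ hn f) ?_,
    fun _ => minCost_negateFirstTwo κ hn⟩
  exact (minCost_negateFirstTwo κ hn).ge.trans
    (le_iSup (fun f => minCost κ 1 1 0 1 f) (negateFirstTwo n))
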